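/- Let $\Omega\subset\mathbb C$ be a bounded domain and let $K_1,K_2:\Omega\times\Omega\to\mathbb C$ be non-negative definite kernels that are sesqui-analytic (holomorphic in the first and anti-holomorphic in the second variable). For a non-negative definite kernel $K:\Omega\times\Omega\to M_k(\mathbb C)$ let $(\mathcal H,K)$ denote the Hilbert space of $\mathbb C^k$-valued functions on $\Omega$ with reproducing kernel $K$. Assume that multiplication by the coordinate function is bounded on $(\mathcal H,K_1)$ and on $(\mathcal H,K_2)$. For $n\in\{0,1,2,\dots\}$ put $$J_n(K_1,K_2)_{|\mathrm{res}\,\Delta}(z,w)=\Big(K_1(z,w)\,\big(\tfrac{\partial}{\partial z}\big)^i\big(\tfrac{\partial}{\partial\bar w}\big)^jK_2(z,w)\Big)_{i,j=0}^n,\qquad z,w\in\Omega .$$ For $\psi$ holomorphic on $\Omega$ let $(\mathcal J_n\psi)(z)$ be the lower triangular $(n+1)\times(n+1)$ matrix with $(i,j)$ entry $\binom ij\psi^{(i-j)}(z)$ for $0\le j\le i\le n$. For $\varphi:\Omega\to\Omega$ holomorphic let $(\mathcal B_n\varphi)(z)$ be the block diagonal $(n+1)\times(n+1)$ matrix with blocks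 $1$ and $\big(B_{i,j}(\varphi^{(1)}(z),\dots,\varphi^{(i-j+1)}(z))\big)_{i,j=1}^n$, where $B_{i,j}$ are the partial Bell polynomials ($B_{i,j}(x_1,x_2,\dots)$ is the sum, over all partitions of an $i$-element set into $j$ nonempty blocks, of the product of the $x_b$ over the block sizes $b$; so $B_{i,j}=0$ for $i<j$). For a holomorphic matrix-valued function $\Psi$ on $\Omega$ write $M_\Psi C_\varphi f=\Psi\cdot(f\circ\varphi)$. Then $J_n(K_1,K_2)_{|\mathrm{res}\,\Delta}$ is a non-negative definite kernel. Let further $\psi_1,\psi_2$ be holomorphic functions on $\Omega$ and let $\varphi\in\mathrm{Aut}(\Omega)$ be a biholomorphic automorphism of $\Omega$. (i) If the operators $M_{\psi_1}C_\varphi$ on $(\mathcal H,K_1)$ and $M_{\psi_2}C_\varphi$ on $(\mathcal H,K_2)$ are bounded and invertible, then so is the operator $M_{\psi_1(\mathcal J_n\psi_2)(\mathcal B_n\varphi)}C_\varphi$ on $(\mathcal H,J_n(K_1,K_2)_{|\mathrm{res}\,\Delta})$. (ii) If the operators $M_{\psi_1}C_\varphi$ on $(\mathcal H,K_1)$ and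 $M_{\psi_2}C_\varphi$ on $(\mathcal H,K_2)$ are unitary, then so is the operator $M_{\psi_1(\mathcal J_n\psi_2)(\mathcal B_n\varphi)}C_\varphi$ on $(\mathcal H,J_n(K_1,K_2)_{|\mathrm{res}\,\Delta})$. -/

import Mathlib

namespace JetKernel

noncomputable section

/-- `φ` restricts to a biholomorphic automorphism of `Ω`. -/
structure IsAut (Ω : Set ℂ) (φ : ℂ → ℂ) : Prop where
  differentiableOn : DifferentiableOn ℂ φ Ω
  mapsTo : Set.MapsTo φ Ω Ω
  exists_inverse : ∃ χ : ℂ → ℂ, DifferentiableOn ℂ χ Ω ∧ Set.MapsTo χ Ω Ω ∧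
    Set.LeftInvOn χ φ Ω ∧ Set.RightInvOn χ φ Ω

/-- `K` is holomorphic in its first and anti-holomorphic in its second variable on `Ω × Ω`:
`(z, u) ↦ K z (conj u)` is a holomorphic function of two variables on
`{(z, u) | z ∈ Ω, conj u ∈ Ω}`. -/
def SesquiAnalyticOn (Ω : Set ℂ) (K : ℂ → ℂ → ℂ) : Prop :=
  DifferentiableOn ℂ (fun p : ℂ × ℂ => K p.1 (starRingEnd ℂ p.2))
    (Ω ×ˢ (starRingEnd ℂ ⁻¹' Ω))

/-- The mixed derivative `(∂/∂z)^i (∂/∂w̄)^j K (z, w)` of a sesqui-analytic function. The `j`-th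
derivative in `w̄` of the anti-holomorphic function `K z` at `w` is the `j`-th complex derivative of
the holomorphic function `u ↦ K z (conj u)` at `u = conj w`. -/
def mixedDeriv (i j : ℕ) (K : ℂ → ℂ → ℂ) (z w : ℂ) : ℂ :=
  iteratedDeriv i
    (fun ζ => iteratedDeriv j (fun u => K ζ (starRingEnd ℂ u)) (starRingEnd ℂ w)) z

/-- A scalar kernel on `Ω`, as an operator-valued kernel for the coefficient space `ℂ`. -/
def scalarKernel (Ω : Set ℂ) (K : ℂ → ℂ → ℂ) : Matrix Ω Ω (ℂ →L[ℂ] ℂ) :=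
  Matrix.of fun z w => K z w • ContinuousLinearMap.id ℂ ℂ

/-- The kernel `J_n(K₁, K₂)|res Δ`, i.e. `(K₁(z, w) (∂/∂z)^i (∂/∂w̄)^j K₂(z, w))_{i, j = 0}^n`. -/
def jetKernel (Ω : Set ℂ) (n : ℕ) (K₁ K₂ : ℂ → ℂ → ℂ) :
    Matrix Ω Ω (EuclideanSpace ℂ (Fin (n + 1)) →L[ℂ] EuclideanSpace ℂ (Fin (n + 1))) :=
  Matrix.of fun z w => Matrix.toEuclideanCLM (n := Fin (n + 1)) (𝕜 := ℂ)
    (Matrix.of fun i j : Fin (n + 1) => K₁ z w * mixedDeriv i j K₂ z w)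

/-- The lower triangular matrix `(𝒥_n ψ)(z)`, with entries `binom(i, j) ψ^{(i-j)}(z)` for
`0 ≤ j ≤ i ≤ n`. -/
def jetMatrix (n : ℕ) (ψ : ℂ → ℂ) (z : ℂ) : Matrix (Fin (n + 1)) (Fin (n + 1)) ℂ :=
  Matrix.of fun i j : Fin (n + 1) =>
    if j ≤ i then ((i : ℕ).choose j : ℂ) * iteratedDeriv ((i : ℕ) - j) ψ z else 0

/-- The partial Bell polynomial `B_{i, j}(x₁, x₂, …)`: the sum, over all partitions of a set of `i`
elements into `j` nonempty blocks, of the product of `x_b` over the block sizes `b`.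
(An `OrderedFinpartition i` is a partition of `Fin i`, its blocks being listed in the order of
their greatest elements; each set partition occurs exactly once.) In particular `B_{0, 0} = 1`,
`B_{i, 0} = B_{0, j} = 0` for `i, j ≥ 1`, and `B_{i, j} = 0` for `j > i`. -/
def bellPoly (i j : ℕ) (x : ℕ → ℂ) : ℂ :=
  ∑ c : OrderedFinpartition i, if c.length = j then ∏ m, x (c.partSize m) else 0

/-- The matrix `(ℬ_n φ)(z)`. By the values of `B_{0, 0}`, `B_{i, 0}` and `B_{0, j}` it is
block diagonal, with blocks `1` and `(B_{i, j}(φ'(z), φ''(z), …))_{i, j = 1}^n`. -/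
def bellMatrix (n : ℕ) (φ : ℂ → ℂ) (z : ℂ) : Matrix (Fin (n + 1)) (Fin (n + 1)) ℂ :=
  Matrix.of fun i j : Fin (n + 1) => bellPoly i j (fun m => iteratedDeriv m φ z)

/-- The scalar weight `ψ`, acting on `ℂ` by multiplication. -/
def scalarWeight (Ω : Set ℂ) (ψ : ℂ → ℂ) (z : Ω) : ℂ →L[ℂ] ℂ :=
  ψ z • ContinuousLinearMap.id ℂ ℂ

/-- The matrix weight `ψ₁ (𝒥_n ψ₂) (ℬ_n φ)`, acting on `ℂ^{n+1}`. -/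
def jetWeight (Ω : Set ℂ) (n : ℕ) (ψ₁ ψ₂ φ : ℂ → ℂ) (z : Ω) :
    EuclideanSpace ℂ (Fin (n + 1)) →L[ℂ] EuclideanSpace ℂ (Fin (n + 1)) :=
  Matrix.toEuclideanCLM (n := Fin (n + 1)) (𝕜 := ℂ)
    (ψ₁ z • (jetMatrix n ψ₂ z * bellMatrix n φ z))

section Operators

variable {X V H : Type*} [NormedAddCommGroup V] [InnerProductSpace ℂ V]
  [NormedAddCommGroup H] [InnerProductSpace ℂ H] [RKHS ℂ H X V]

/-- The bounded operator `T` on the space `H` of `V`-valued functions on `X` is the weighted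
composition operator `M_Ψ C_φ : f ↦ Ψ · (f ∘ φ)`. -/
def IsWeightedComp (Ψ : X → V →L[ℂ] V) (φ : X → X) (T : H →L[ℂ] H) : Prop :=
  ∀ (f : H) (x : X), T f x = Ψ x (f (φ x))

variable (H)

/-- `M_Ψ C_φ` maps `H` into itself and is bounded. -/
def WeightedCompBounded (Ψ : X → V →L[ℂ] V) (φ : X → X) : Prop :=
  ∃ T : H →L[ℂ] H, IsWeightedComp Ψ φ T

/-- `M_Ψ C_φ` is bounded and invertible on `H`. -/
def WeightedCompInvertible (Ψ : X → V →L[ℂ] V) (φ : X → X) : Prop :=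
  ∃ T : H →L[ℂ] H, IsWeightedComp Ψ φ T ∧ IsUnit T

/-- `M_Ψ C_φ` is a unitary operator on `H`. -/
def WeightedCompUnitary [CompleteSpace H] (Ψ : X → V →L[ℂ] V) (φ : X → X) : Prop :=
  ∃ T : H →L[ℂ] H, IsWeightedComp Ψ φ T ∧ T ∈ unitary (H →L[ℂ] H)

end Operators

end

end JetKernel

namespace JetKernel

open scoped InnerProductSpace TensorProduct ComplexConjugate
open Filter Topology

/-! Write `κᵢ u` for the kernel function of `Hᵢ` at `conj u` (`kerMap`). It is a holomorphic
`Hᵢ`-valued map, and the mixed derivatives of `K₂` are the inner products of the derivatives of `κ₂`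
(`mixedDeriv_eq_inner`). Hence the jet kernel is the Gram kernel of the vectors `κ₁ (conj a) ⊗ ∑ vⱼ
κ₂⁽ʲ⁾ (conj a)` in `H₁ ⊗ H₂` (`isGram_jetFactor`), which makes it non-negative definite.

The adjoint of `M_ψ C_φ` sends `κ u` to a scalar multiple of `κ (conj (φ (conj u)))`.
Differentiating this by Leibniz and Faà di Bruno shows that `T₁* ⊗ T₂*` acts on these vectors
through the adjoint of the jet weight (`mapL_jetFactor`). The kernel functions of `H` have the same
Gram matrices, so `T₁* ⊗ T₂*` induces an operator `R` on `H` with the same upper and lower norm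
bounds, and `R*` is the jet weighted composition operator (`exists_isWeightedComp`).

The lower bound gives closed range, so invertibility of `R` reduces to injectivity of `R*`. The jet
weight is an invertible matrix off the zeros of `ψ₁ ψ₂`; these zeros are isolated unless a space is
trivial, and elements of `H` are continuous. In the unitary case all the constants are at most one,
so `R` is isometric. -/

/-! ### Weak holomorphy implies holomorphy -/

/-- A continuous function with values in a Hilbert space is holomorphic if its inner products with
a total set are. -/
lemma differentiableOn_of_inner {H : Type*} [NormedAddCommGroup H] [InnerProductSpace ℂ H]
    [CompleteSpace H] {U : Set ℂ} (hU : IsOpen U) {κ : ℂ → H} (hκ : ContinuousOn κ U) {S : Set H}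
    (hS : (Submodule.span ℂ S).topologicalClosure = ⊤)
    (h : ∀ s ∈ S, DifferentiableOn ℂ (fun u => ⟪s, κ u⟫_ℂ) U) : DifferentiableOn ℂ κ U := by
  intro c hc
  obtain ⟨r, hr, hrU⟩ := Metric.nhds_basis_closedBall.mem_iff.1 (hU.mem_nhds hc)
  lift r to NNReal using hr.le
  have hcont : ContinuousOn κ (Metric.sphere c r) :=
    hκ.mono (Metric.sphere_subset_closedBall.trans hrU)
  -- The Cauchy integral of a merely continuous `κ` is already analytic inside the circle; that it
  -- equals `κ` there can be tested against `S`, where Cauchy's formula is scalar.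
  have hps := hasFPowerSeriesOn_cauchy_integral (hcont.circleIntegrable r.2) (by exact_mod_cast hr)
  refine (DifferentiableAt.congr_of_eventuallyEq (hps.analyticAt.differentiableAt)
    ?_).differentiableWithinAt
  filter_upwards [Metric.ball_mem_nhds c hr] with w hw
  have hort : ∀ s ∈ S, ⟪s, κ w⟫_ℂ =
      ⟪s, (2 * Real.pi * Complex.I : ℂ)⁻¹ • ∮ z in C(c, r), (z - w)⁻¹ • κ z⟫_ℂ := by
    intro s hs
    have h1 := ((h s hs).mono hrU).circleIntegral_sub_inv_smul hw
    have hci : CircleIntegrable (fun z => (z - w)⁻¹ • κ z) c r := by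
      refine ContinuousOn.circleIntegrable r.2 (ContinuousOn.smul ?_ hcont)
      refine ContinuousOn.inv₀ (by fun_prop) fun z hz => ?_
      rw [sub_ne_zero]
      rintro rfl
      simp only [Metric.mem_sphere, Metric.mem_ball] at hz hw
      exact hw.ne hz
    have h2 : (∮ z in C(c, r), (z - w)⁻¹ • ⟪s, κ z⟫_ℂ) =
        ⟪s, ∮ z in C(c, r), (z - w)⁻¹ • κ z⟫_ℂ := by
      have := ContinuousLinearMap.intervalIntegral_comp_comm (innerSL ℂ s) hci.out
      simp only [circleIntegral]
      simpa [inner_smul_right] using this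
    rw [inner_smul_right, ← h2, h1, smul_eq_mul, inv_mul_cancel_left₀]
    simp [Real.pi_ne_zero]
  have hdense : Dense (Submodule.span ℂ S : Set H) := by
    rw [Submodule.dense_iff_topologicalClosure_eq_top]; exact hS
  refine hdense.eq_of_inner_right ℂ fun v hv => ?_
  induction hv using Submodule.span_induction with
  | mem x hx => exact hort x hx
  | zero => simp
  | add x y _ _ hx hy => simp only [inner_add_left, hx, hy]
  | smul a x _ hx => simp only [inner_smul_left, hx]

/-! ### Factorizations of operator-valued kernels and induced operators -/

section Gram

variable {X V E H : Type*} [NormedAddCommGroup V] [InnerProductSpace ℂ V]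
  [NormedAddCommGroup E] [InnerProductSpace ℂ E] [NormedAddCommGroup H] [InnerProductSpace ℂ H]
  {K : Matrix X X (V →L[ℂ] V)} {Γ : X → V →ₗ[ℂ] E} {Γ' : X → V →ₗ[ℂ] H}

/-- The family `Γ` is a factorization of the operator-valued kernel `K`. -/
def IsGram (K : Matrix X X (V →L[ℂ] V)) (Γ : X → V →ₗ[ℂ] E) : Prop :=
  ∀ a b u v, ⟪Γ a u, Γ b v⟫_ℂ = ⟪u, K a b v⟫_ℂ

lemma IsGram.inner_lsum (hΓ : IsGram K Γ) (f g : X →₀ V) :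
    ⟪Finsupp.lsum ℂ Γ f, Finsupp.lsum ℂ Γ g⟫_ℂ =
      f.sum fun a u => g.sum fun b v => ⟪u, K a b v⟫_ℂ := by
  rw [Finsupp.sum_comm]
  simp only [Finsupp.lsum_apply, Finsupp.sum_inner, Finsupp.inner_sum, hΓ _ _ _ _]

/-- Norms of finite combinations depend on the kernel alone. This carries every estimate from the
tensor product to the reproducing kernel space. -/
lemma IsGram.norm_lsum_eq (hΓ : IsGram K Γ) (hΓ' : IsGram K Γ') (f : X →₀ V) :
    ‖Finsupp.lsum ℂ Γ f‖ = ‖Finsupp.lsum ℂ Γ' f‖ := by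
  rw [@norm_eq_sqrt_re_inner ℂ, @norm_eq_sqrt_re_inner ℂ, hΓ.inner_lsum, hΓ'.inner_lsum]

lemma IsGram.posSemidef [CompleteSpace V] (hΓ : IsGram K Γ) : K.PosSemidef := by
  have hconj : ∀ a b u v, ⟪K a b u, v⟫_ℂ = ⟪Γ b u, Γ a v⟫_ℂ := fun a b u v => by
    rw [← inner_conj_symm, ← hΓ, inner_conj_symm]
  refine ((RKHS.posSemidef_tfae (K := K)).out 0 2 rfl rfl).2 ⟨?_, fun f => ?_⟩
  · ext a b : 1
    refine ContinuousLinearMap.ext fun u => ext_inner_left ℂ fun v => ?_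
    rw [Matrix.conjTranspose_apply, ContinuousLinearMap.star_eq_adjoint,
      ContinuousLinearMap.adjoint_inner_right, hconj, hΓ]
  · have : (f.sum fun x w => f.sum fun x' w' => ⟪K x' x w, w'⟫_ℂ) =
        ⟪Finsupp.lsum ℂ Γ f, Finsupp.lsum ℂ Γ f⟫_ℂ := by
      rw [Finsupp.sum_comm]
      simp only [Finsupp.lsum_apply, Finsupp.sum_inner, Finsupp.inner_sum, hconj]
    rw [this]
    exact inner_self_nonneg

variable [CompleteSpace V] [CompleteSpace H] [RKHS ℂ H X V]

lemma isGram_kerFun : IsGram (RKHS.kernel H) fun x => (RKHS.kerFun H x).toLinearMap := by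
  intro a b u v
  rw [← RKHS.kerFun_apply, ← RKHS.kerFun_inner]
  rfl

lemma denseRange_lsum_kerFun :
    DenseRange (Finsupp.lsum ℂ fun x : X => (RKHS.kerFun H x).toLinearMap) := by
  have h := RKHS.kerFun_dense (H := H)
  rw [← Submodule.dense_iff_topologicalClosure_eq_top] at h
  refine h.mono ?_
  rw [← LinearMap.coe_range, SetLike.coe_subset_coe, Submodule.span_le]
  rintro _ ⟨x, v, rfl⟩
  exact ⟨Finsupp.single x v, by simp⟩

/-- A bounded operator which acts on a factorization of the kernel like the adjoint of a weighted
composition operator induces this adjoint on the reproducing kernel Hilbert space. -/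
lemma exists_isWeightedComp (hΓ : IsGram (RKHS.kernel H) Γ) {φ : X → X} {Ψ : X → V →L[ℂ] V}
    {S : E →L[ℂ] E} (hS : ∀ b v, S (Γ b v) = Γ (φ b) ((Ψ b).adjoint v)) {c C : ℝ}
    (hC : ∀ x, ‖S x‖ ≤ C * ‖x‖) (hc : ∀ x, ‖x‖ ≤ c * ‖S x‖) :
    ∃ R : H →L[ℂ] H, IsWeightedComp Ψ φ R.adjoint ∧ (∀ h, ‖R h‖ ≤ C * ‖h‖) ∧
      ∀ h, ‖h‖ ≤ c * ‖R h‖ := by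
  set A : (X →₀ V) →ₗ[ℂ] H := Finsupp.lsum ℂ fun x => (RKHS.kerFun H x).toLinearMap
  set W : (X →₀ V) →ₗ[ℂ] (X →₀ V) :=
    Finsupp.lsum ℂ fun b => Finsupp.lsingle (φ b) ∘ₗ (Ψ b).adjoint.toLinearMap
  have hA : ∀ f, ‖A f‖ = ‖Finsupp.lsum ℂ Γ f‖ := fun f => isGram_kerFun.norm_lsum_eq hΓ f
  have hW : ∀ f, Finsupp.lsum ℂ Γ (W f) = S (Finsupp.lsum ℂ Γ f) := by
    intro f
    have : Finsupp.lsum ℂ Γ ∘ₗ W = S.toLinearMap ∘ₗ Finsupp.lsum ℂ Γ := by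
      ext b v
      simp [W, hS]
    exact LinearMap.congr_fun this f
  have hd : DenseRange A := denseRange_lsum_kerFun
  have hB : ∀ f, ‖(A ∘ₗ W) f‖ ≤ C * ‖A f‖ := fun f => by
    rw [LinearMap.comp_apply, hA, hA, hW]; exact hC _
  -- By `hB` the vector `A (W f)` depends only on `A f`, so `A f ↦ A (W f)` is well defined and
  -- extends from the dense range of `A`. No completeness of `E` is needed, so the algebraic tensor
  -- product suffices.
  have hR : ∀ f, (A ∘ₗ W).extendOfNorm A (A f) = (A ∘ₗ W) f :=
    LinearMap.extendOfNorm_eq hd ⟨C, hB⟩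
  refine ⟨(A ∘ₗ W).extendOfNorm A, fun f x => ext_inner_left ℂ fun v => ?_,
    LinearMap.norm_extendOfNorm_apply_le hd C hB, fun h => ?_⟩
  · have hk := hR (Finsupp.single x v)
    simp only [A, W, LinearMap.comp_apply, Finsupp.lsum_single, Finsupp.lsingle_apply,
      ContinuousLinearMap.coe_coe] at hk
    rw [← RKHS.kerFun_inner, ContinuousLinearMap.adjoint_inner_right, hk, RKHS.kerFun_inner,
      ContinuousLinearMap.adjoint_inner_left]
  · refine hd.induction (P := fun h => ‖h‖ ≤ c * ‖(A ∘ₗ W).extendOfNorm A h‖) ?_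
      (isClosed_le (by fun_prop) (by fun_prop)) h
    rintro _ ⟨f, rfl⟩
    rw [hR, LinearMap.comp_apply, hA, hA, hW]
    exact hc _

end Gram

/-- A bounded operator which is bounded below and has injective adjoint is invertible. -/
lemma isUnit_of_bounded_below {H : Type*} [NormedAddCommGroup H] [InnerProductSpace ℂ H]
    [CompleteSpace H] {R : H →L[ℂ] H} {c : ℝ} (hc : ∀ h, ‖h‖ ≤ c * ‖R h‖)
    (hinj : Function.Injective R.adjoint) : IsUnit R := by
  have hanti : AntilipschitzWith c.toNNReal R := by
    refine AddMonoidHomClass.antilipschitz_of_bound R fun x => (hc x).trans ?_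
    gcongr
    exact Real.le_coe_toNNReal c
  have hclosed : IsClosed (R.range : Set H) := by
    rw [LinearMap.coe_range]
    exact hanti.isClosed_range R.uniformContinuous
  have hker : R.rangeᗮ = ⊥ := by
    rw [ContinuousLinearMap.orthogonal_range]
    exact LinearMap.ker_eq_bot.2 hinj
  have htop : R.range = ⊤ := by
    rw [Submodule.topologicalClosure_eq_top_iff.2 hker |>.symm,
      hclosed.submodule_topologicalClosure_eq]
  rw [ContinuousLinearMap.isUnit_iff_bijective]
  exact ⟨hanti.injective, LinearMap.range_eq_top.1 htop⟩

/-! ### Higher derivatives: conjugation, Leibniz, Faà di Bruno -/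

section Calculus

variable {F : Type*} [NormedAddCommGroup F] [NormedSpace ℂ F] {U : Set ℂ}

lemma _root_.DifferentiableOn.contDiffAt_of_isOpen [CompleteSpace F] {f : ℂ → F}
    (hf : DifferentiableOn ℂ f U) (hU : IsOpen U) {u : ℂ} (hu : u ∈ U) (n : ℕ) :
    ContDiffAt ℂ n f u :=
  (hf.analyticAt (hU.mem_nhds hu)).contDiffAt

/-- Kernel functions are holomorphic in the conjugate variable, so symbols on `Ω` enter as `u ↦ conj
(f (conj u))`. This identity and its consequences `jetMatrix_conj` and `bellMatrix_conj` return to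
the original symbols. -/
lemma iteratedDeriv_conj_conj (i : ℕ) (f : ℂ → ℂ) :
    iteratedDeriv i (fun z => conj (f (conj z))) = fun z => conj (iteratedDeriv i f (conj z)) := by
  induction i with
  | zero => simp
  | succ i ih =>
    rw [iteratedDeriv_succ, ih, iteratedDeriv_succ]
    funext z
    exact congrFun (deriv_conj_conj (f := iteratedDeriv i f)) z

lemma iteratedDeriv_clm_apply [CompleteSpace F] {G : Type*} [NormedAddCommGroup G]
    [NormedSpace ℂ G] (L : F →L[ℂ] G) {f : ℂ → F} (hf : DifferentiableOn ℂ f U) (hU : IsOpen U)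
    (i : ℕ) {u : ℂ} (hu : u ∈ U) :
    iteratedDeriv i (fun v => L (f v)) u = L (iteratedDeriv i f u) := by
  rw [iteratedDeriv_eq_iteratedFDeriv, iteratedDeriv_eq_iteratedFDeriv]
  rw [show (fun v => L (f v)) = L ∘ f from rfl,
    L.iteratedFDeriv_comp_left (hf.contDiffAt_of_isOpen hU hu i) le_rfl]
  rfl

lemma jetMatrix_conj (n : ℕ) (ψ : ℂ → ℂ) (z : ℂ) :
    jetMatrix n (fun u => conj (ψ (conj u))) (conj z) = (jetMatrix n ψ z).map conj := by
  ext i j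
  simp [jetMatrix, iteratedDeriv_conj_conj, apply_ite (starRingEnd ℂ)]

lemma bellMatrix_conj (n : ℕ) (φ : ℂ → ℂ) (z : ℂ) :
    bellMatrix n (fun u => conj (φ (conj u))) (conj z) = (bellMatrix n φ z).map conj := by
  ext i j
  simp [bellMatrix, bellPoly, iteratedDeriv_conj_conj, apply_ite (starRingEnd ℂ)]

lemma iteratedDeriv_comp_eq_sum_bellPoly [CompleteSpace F] {n k : ℕ} (hk : k ≤ n) {f : ℂ → F}
    {q : ℂ → ℂ} {u : ℂ} (hf : ContDiffAt ℂ k f (q u)) (hq : ContDiffAt ℂ k q u) :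
    iteratedDeriv k (fun v => f (q v)) u = ∑ l : Fin (n + 1),
      bellPoly k l (fun m => iteratedDeriv m q u) • iteratedDeriv l f (q u) := by
  have h := iteratedDeriv_scomp_eq_sum_orderedFinpartition hf hq le_rfl
  rw [show (fun v => f (q v)) = f ∘ q from rfl, h]
  simp only [bellPoly, Finset.sum_smul]
  rw [Finset.sum_comm]
  refine Finset.sum_congr rfl fun c _ => ?_
  -- A partition contributes only to the index equal to its number of blocks, which is at most `k ≤
  -- n`.
  rw [Finset.sum_eq_single (⟨c.length, by have := c.length_le; omega⟩ : Fin (n + 1))]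
  · simp
  · intro l _ hl
    rw [if_neg, zero_smul]
    exact fun h => hl (Fin.ext h.symm)
  · simp

/-- The `n`-jet of a weighted composition: the Leibniz rule and Faà di Bruno's formula combined. -/
lemma iteratedDeriv_smul_comp [CompleteSpace F] {n : ℕ} {f : ℂ → F} {p q : ℂ → ℂ}
    (hU : IsOpen U) (hf : DifferentiableOn ℂ f U) (hp : DifferentiableOn ℂ p U)
    (hq : DifferentiableOn ℂ q U) (hqU : Set.MapsTo q U U) {u : ℂ} (hu : u ∈ U) (j : Fin (n + 1)) :
    iteratedDeriv j (fun v => p v • f (q v)) u = ∑ l : Fin (n + 1),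
      (jetMatrix n p u * bellMatrix n q u) j l • iteratedDeriv l f (q u) := by
  have hfq : DifferentiableOn ℂ (fun v => f (q v)) U := hf.comp hq hqU
  have h := iteratedDerivWithin_smul (Set.mem_univ u) uniqueDiffOn_univ (n := j)
    (hp.contDiffAt_of_isOpen hU hu j).contDiffWithinAt
    (hfq.contDiffAt_of_isOpen hU hu j).contDiffWithinAt
  simp only [iteratedDerivWithin_univ] at h
  rw [show (fun v => p v • f (q v)) = p • fun v => f (q v) from rfl, h, ← Finset.sum_flip]
  have hl : ∀ k ∈ Finset.range ((j : ℕ) + 1), (j : ℕ).choose (j - k) •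
      iteratedDeriv (j - k) p u • iteratedDeriv (j - (j - k)) (fun v => f (q v)) u =
      ((j : ℕ).choose k * iteratedDeriv (j - k) p u : ℂ) •
        iteratedDeriv k (fun v => f (q v)) u := by
    intro k hk
    have hk' : k ≤ j := by simpa [Nat.lt_succ_iff] using hk
    rw [Nat.choose_symm hk', Nat.sub_sub_self hk', mul_smul, Nat.cast_smul_eq_nsmul]
  rw [Finset.sum_congr rfl hl]
  have hr : ∀ l : Fin (n + 1), (jetMatrix n p u * bellMatrix n q u) j l •
      iteratedDeriv l f (q u) = ∑ k : Fin (n + 1), jetMatrix n p u j k •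
        (bellMatrix n q u k l • iteratedDeriv l f (q u)) := by
    intro l
    simp only [Matrix.mul_apply, Finset.sum_smul, mul_smul]
  simp only [hr]
  rw [Finset.sum_comm]
  simp only [← Finset.smul_sum]
  have hb : ∀ k : Fin (n + 1), ∑ l : Fin (n + 1), bellMatrix n q u k l • iteratedDeriv l f (q u) =
      iteratedDeriv k (fun v => f (q v)) u := fun k =>
    (iteratedDeriv_comp_eq_sum_bellPoly (Nat.lt_succ_iff.1 k.2)
      (hf.contDiffAt_of_isOpen hU (hqU hu) k) (hq.contDiffAt_of_isOpen hU hu k)).symm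
  simp only [hb, jetMatrix, Matrix.of_apply, ite_smul, zero_smul, Fin.le_iff_val_le_val]
  -- The triangular shape of `jetMatrix` cuts the sum over `0, …, n` down to the Leibniz range `k ≤
  -- j`.
  rw [Fin.sum_univ_eq_sum_range (fun k => if k ≤ (j : ℕ) then
    ((j : ℕ).choose k * iteratedDeriv (j - k) p u : ℂ) • iteratedDeriv k (fun v => f (q v)) u
      else 0) (n + 1)]
  rw [← Finset.sum_filter]
  refine Finset.sum_congr ?_ fun _ _ => rfl
  ext k
  simp only [Finset.mem_range, Finset.mem_filter]
  omega

end Calculus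

/-! ### The holomorphic parametrization of kernel functions -/

section KernelMap

variable {Ω : Set ℂ} {H : Type*} [NormedAddCommGroup H] [InnerProductSpace ℂ H] [CompleteSpace H]
  [RKHS ℂ H Ω ℂ]

open Classical in
variable (Ω H) in
/-- The kernel functions of a space of scalar functions on `Ω`, parametrized holomorphically: the
value at `u` is the kernel function at `conj u`, extended by zero. -/
noncomputable def kerMap (u : ℂ) : H :=
  if h : conj u ∈ Ω then RKHS.kerFun H (⟨conj u, h⟩ : Ω) 1 else 0

lemma kerMap_conj (z : Ω) : kerMap Ω H (conj (z : ℂ)) = RKHS.kerFun H z 1 := by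
  simp [kerMap]

lemma inner_kerMap {K : ℂ → ℂ → ℂ} (hH : RKHS.kernel H = scalarKernel Ω K) {u v : ℂ}
    (hu : conj u ∈ Ω) (hv : conj v ∈ Ω) :
    ⟪kerMap Ω H u, kerMap Ω H v⟫_ℂ = K (conj u) (conj v) := by
  rw [kerMap, kerMap, dif_pos hu, dif_pos hv, RKHS.kerFun_inner, RKHS.kerFun_apply, hH]
  simp [scalarKernel]

lemma span_kerMap_topologicalClosure :
    (Submodule.span ℂ (kerMap Ω H '' (conj ⁻¹' Ω))).topologicalClosure = ⊤ := by
  rw [eq_top_iff, ← RKHS.kerFun_dense (H := H)]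
  refine Submodule.topologicalClosure_mono (Submodule.span_le.2 ?_)
  rintro _ ⟨x, v, rfl⟩
  have : RKHS.kerFun H x v = v • kerMap Ω H (conj (x : ℂ)) := by
    rw [kerMap_conj, ← map_smul, smul_eq_mul, mul_one]
  rw [this]
  exact Submodule.smul_mem _ _ (Submodule.subset_span ⟨_, by simp, rfl⟩)

lemma isOpen_conj_preimage (hΩ : IsOpen Ω) : IsOpen (conj ⁻¹' Ω : Set ℂ) :=
  hΩ.preimage Complex.continuous_conj

variable {K : ℂ → ℂ → ℂ}

/-- Expanding `‖κ v - κ u‖²` gives four values of `K`, continuous in `v`, which cancel at `v = u`.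
-/
lemma continuousOn_kerMap (hK : SesquiAnalyticOn Ω K)
    (hH : RKHS.kernel H = scalarKernel Ω K) : ContinuousOn (kerMap Ω H) (conj ⁻¹' Ω) := by
  intro u hu
  rw [ContinuousWithinAt, tendsto_iff_norm_sub_tendsto_zero]
  have hG := DifferentiableOn.continuousOn hK
  have key : Tendsto (fun v => Complex.re (K (conj v) (conj v) - K (conj v) (conj u) -
      K (conj u) (conj v) + K (conj u) (conj u))) (𝓝[conj ⁻¹' Ω] u) (𝓝 0) := by
    have h1 : ∀ a b : ℂ → ℂ, ContinuousOn a (conj ⁻¹' Ω) → ContinuousOn b (conj ⁻¹' Ω) →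
        Set.MapsTo a (conj ⁻¹' Ω) Ω → Set.MapsTo b (conj ⁻¹' Ω) (conj ⁻¹' Ω) →
        Tendsto (fun v => K (a v) (conj (b v))) (𝓝[conj ⁻¹' Ω] u) (𝓝 (K (a u) (conj (b u)))) :=
      fun a b ha hb ha' hb' =>
        (hG.comp (ha.prodMk hb) fun v hv => ⟨ha' hv, hb' hv⟩) u hu
    have hc : ContinuousOn (fun v : ℂ => conj v) (conj ⁻¹' Ω) :=
      Complex.continuous_conj.continuousOn
    have t1 := h1 (fun v => conj v) (fun v => v) hc continuousOn_id (fun v hv => hv)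
      fun v hv => hv
    have t2 := h1 (fun v => conj v) (fun _ => u) hc continuousOn_const (fun v hv => hv)
      fun _ _ => hu
    have t3 := h1 (fun _ => conj u) (fun v => v) continuousOn_const continuousOn_id
      (fun _ _ => hu) fun v hv => hv
    have t := (Complex.continuous_re.tendsto _).comp
      (((t1.sub t2).sub t3).add (tendsto_const_nhds (x := K (conj u) (conj u))))
    simpa [Function.comp_def] using t
  have hsq : Tendsto (fun v => ‖kerMap Ω H v - kerMap Ω H u‖ ^ 2) (𝓝[conj ⁻¹' Ω] u) (𝓝 0) := by
    refine key.congr' ?_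
    filter_upwards [self_mem_nhdsWithin] with v hv
    rw [← inner_self_eq_norm_sq (𝕜 := ℂ), inner_sub_left, inner_sub_right, inner_sub_right,
      inner_kerMap hH hv hv, inner_kerMap hH hv hu, inner_kerMap hH hu hv, inner_kerMap hH hu hu]
    simp only [RCLike.re_to_complex]
    congr 1
    ring
  simpa [Real.sqrt_sq] using hsq.sqrt

/-- Tested against the kernel functions, which form a total set, `κ` becomes `v ↦ K (conj u) (conj
v)`, holomorphic by assumption. -/
lemma differentiableOn_kerMap (hΩ : IsOpen Ω) (hK : SesquiAnalyticOn Ω K)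
    (hH : RKHS.kernel H = scalarKernel Ω K) : DifferentiableOn ℂ (kerMap Ω H) (conj ⁻¹' Ω) := by
  refine differentiableOn_of_inner (isOpen_conj_preimage hΩ) (continuousOn_kerMap hK hH)
    span_kerMap_topologicalClosure ?_
  rintro _ ⟨u, hu, rfl⟩
  have h : DifferentiableOn ℂ (fun v => K (conj u) (conj v)) (conj ⁻¹' Ω) :=
    DifferentiableOn.comp (t := Ω ×ˢ (conj ⁻¹' Ω)) (f := fun v : ℂ => (conj u, v)) hK
      (by fun_prop) fun v hv => ⟨hu, hv⟩
  exact h.congr fun v hv => inner_kerMap hH hu hv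

lemma mixedDeriv_eq_inner (hΩ : IsOpen Ω) (hK : SesquiAnalyticOn Ω K)
    (hH : RKHS.kernel H = scalarKernel Ω K) (i j : ℕ) {z w : ℂ} (hz : z ∈ Ω) (hw : w ∈ Ω) :
    mixedDeriv i j K z w =
      ⟪iteratedDeriv i (kerMap Ω H) (conj z), iteratedDeriv j (kerMap Ω H) (conj w)⟫_ℂ := by
  have hU := isOpen_conj_preimage hΩ
  have hκ := differentiableOn_kerMap hΩ hK hH
  have hz' : conj z ∈ (conj ⁻¹' Ω : Set ℂ) := by simpa
  have hw' : conj w ∈ (conj ⁻¹' Ω : Set ℂ) := by simpa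
  set x := iteratedDeriv j (kerMap Ω H) (conj w)
  have h1 : ∀ ζ ∈ Ω, iteratedDeriv j (fun u => K ζ (conj u)) (conj w) =
      ⟪kerMap Ω H (conj ζ), x⟫_ℂ := by
    intro ζ hζ
    rw [← innerSL_apply_apply ℂ, ← iteratedDeriv_clm_apply _ hκ hU j hw']
    refine Filter.EventuallyEq.iteratedDeriv_eq j ?_
    filter_upwards [hU.mem_nhds hw'] with u hu
    rw [innerSL_apply_apply, inner_kerMap hH (by simpa) hu, Complex.conj_conj]
  -- The `z`-derivative falls on the conjugate-linear slot; conjugating turns it into a continuous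
  -- linear functional of `κ`, which commutes with derivatives.
  have h2 : (fun ζ => iteratedDeriv j (fun u => K ζ (conj u)) (conj w)) =ᶠ[𝓝 z]
      fun ζ => conj (innerSL ℂ x (kerMap Ω H (conj ζ))) := by
    filter_upwards [hΩ.mem_nhds hz] with ζ hζ
    rw [h1 ζ hζ, innerSL_apply_apply, inner_conj_symm]
  rw [mixedDeriv, h2.iteratedDeriv_eq,
    iteratedDeriv_conj_conj i (fun u => innerSL ℂ x (kerMap Ω H u)),
    ← inner_conj_symm _ x, ← innerSL_apply_apply ℂ x, ← iteratedDeriv_clm_apply _ hκ hU i hz']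

end KernelMap

/-! ### Pointwise invertibility of the jet weight -/

section Matrices

lemma toEuclideanCLM_apply {ι : Type*} [Fintype ι] [DecidableEq ι] (M : Matrix ι ι ℂ)
    (v : EuclideanSpace ℂ ι) (i : ι) :
    Matrix.toEuclideanCLM (n := ι) (𝕜 := ℂ) M v i = ∑ j, M i j * v j := rfl

lemma bellPoly_eq_zero {i j : ℕ} (h : i < j) (x : ℕ → ℂ) : bellPoly i j x = 0 :=
  Finset.sum_eq_zero fun c _ => if_neg (by have := c.length_le; omega)

/-- The block sizes are at least one and add up to `i`, the number of blocks. -/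
lemma partSize_eq_one {i : ℕ} (c : OrderedFinpartition i) (hc : c.length = i)
    (m : Fin c.length) : c.partSize m = 1 := by
  have hsum : ∑ m, c.partSize m = ∑ _m : Fin c.length, 1 := by
    simpa [hc] using Fintype.card_congr c.equivSigma
  exact ((Finset.sum_eq_sum_iff_of_le fun m _ => c.partSize_pos m).1 hsum.symm m
    (Finset.mem_univ m)).symm

/-- Only partitions into singletons contribute, so the value is a multiple of `x 1 ^ i`. It is
enough that the multiplicity is not zero, which `OrderedFinpartition.atomic` witnesses. -/
lemma bellPoly_self_ne_zero (i : ℕ) {x : ℕ → ℂ} (hx : x 1 ≠ 0) : bellPoly i i x ≠ 0 := by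
  have h : bellPoly i i x =
      ((Finset.univ.filter fun c : OrderedFinpartition i => c.length = i).card : ℂ) * x 1 ^ i := by
    rw [bellPoly, ← Finset.sum_filter, ← nsmul_eq_mul]
    refine Finset.sum_eq_card_nsmul fun c hc => ?_
    have hc' : c.length = i := (Finset.mem_filter.1 hc).2
    simp [partSize_eq_one c hc', hc']
  rw [h]
  refine mul_ne_zero (Nat.cast_ne_zero.2 (Finset.card_ne_zero_of_mem
    (a := OrderedFinpartition.atomic i) ?_)) (pow_ne_zero _ hx)
  simp

lemma det_jetMatrix_ne_zero (n : ℕ) {ψ : ℂ → ℂ} {z : ℂ} (h : ψ z ≠ 0) :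
    (jetMatrix n ψ z).det ≠ 0 := by
  rw [Matrix.det_of_isLowerTriangular]
  · exact Finset.prod_ne_zero_iff.2 fun i _ => by simpa [jetMatrix] using h
  · intro i j hij
    exact if_neg (not_le.2 (by simpa using hij))

lemma det_bellMatrix_ne_zero (n : ℕ) {φ : ℂ → ℂ} {z : ℂ} (h : deriv φ z ≠ 0) :
    (bellMatrix n φ z).det ≠ 0 := by
  rw [Matrix.det_of_isLowerTriangular]
  · exact Finset.prod_ne_zero_iff.2 fun i _ =>
      bellPoly_self_ne_zero (x := fun m => iteratedDeriv m φ z) i (by simpa using h)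
  · intro i j hij
    exact bellPoly_eq_zero (Fin.lt_def.1 (by simpa using hij))
      fun m => iteratedDeriv m φ z

lemma eq_zero_of_jetWeight_apply_eq_zero {Ω : Set ℂ} {n : ℕ} {ψ₁ ψ₂ φ : ℂ → ℂ} {z : Ω}
    (h₁ : ψ₁ z ≠ 0) (h₂ : ψ₂ z ≠ 0) (hφ : deriv φ z ≠ 0) {v : EuclideanSpace ℂ (Fin (n + 1))}
    (hv : jetWeight Ω n ψ₁ ψ₂ φ z v = 0) : v = 0 := by
  have hdet : (ψ₁ z • (jetMatrix n ψ₂ z * bellMatrix n φ z)).det ≠ 0 := by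
    rw [Matrix.det_smul, Matrix.det_mul]
    exact mul_ne_zero (pow_ne_zero _ h₁)
      (mul_ne_zero (det_jetMatrix_ne_zero n h₂) (det_bellMatrix_ne_zero n hφ))
  refine WithLp.ofLp_injective 2 (Matrix.eq_zero_of_mulVec_eq_zero hdet ?_)
  rw [← Matrix.ofLp_toEuclideanCLM]
  exact congrArg WithLp.ofLp hv

lemma IsAut.deriv_ne_zero {Ω : Set ℂ} (hΩ : IsOpen Ω) {φ : ℂ → ℂ} (hφ : IsAut Ω φ) {z : ℂ}
    (hz : z ∈ Ω) : deriv φ z ≠ 0 := by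
  obtain ⟨χ, hχ, -, hleft, -⟩ := hφ.exists_inverse
  have h1 := (hφ.differentiableOn.differentiableAt (hΩ.mem_nhds hz)).hasDerivAt
  have h2 := (hχ.differentiableAt (hΩ.mem_nhds (hφ.mapsTo hz))).hasDerivAt
  have h3 : HasDerivAt (χ ∘ φ) 1 z :=
    (hasDerivAt_id z).congr_of_eventuallyEq (Filter.eventuallyEq_of_mem (hΩ.mem_nhds hz) hleft)
  intro h0
  have := (h2.comp z h1).unique h3
  simp [h0] at this

end Matrices

/-! ### Factorization of the jet kernel through the tensor product -/

section Factor

variable {Ω : Set ℂ}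
  {H₁ : Type*} [NormedAddCommGroup H₁] [InnerProductSpace ℂ H₁] [CompleteSpace H₁] [RKHS ℂ H₁ Ω ℂ]
  {H₂ : Type*} [NormedAddCommGroup H₂] [InnerProductSpace ℂ H₂] [CompleteSpace H₂] [RKHS ℂ H₂ Ω ℂ]
  {K₁ K₂ : ℂ → ℂ → ℂ}

/-- The holomorphic parametrization intertwines the adjoint of a weighted composition operator. -/
lemma adjoint_kerMap {ψ φ : ℂ → ℂ} {hφ : Set.MapsTo φ Ω Ω} {T : H₁ →L[ℂ] H₁}
    (hT : IsWeightedComp (scalarWeight Ω ψ) (hφ.restrict φ Ω Ω) T) {u : ℂ} (hu : conj u ∈ Ω) :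
    T.adjoint (kerMap Ω H₁ u) = conj (ψ (conj u)) • kerMap Ω H₁ (conj (φ (conj u))) := by
  refine ext_inner_right ℂ fun f => ?_
  have h1 : kerMap Ω H₁ u = RKHS.kerFun H₁ ⟨conj u, hu⟩ 1 := by
    rw [← kerMap_conj]; simp
  have h2 : kerMap Ω H₁ (conj (φ (conj u))) =
      RKHS.kerFun H₁ (hφ.restrict φ Ω Ω ⟨conj u, hu⟩) 1 := by
    rw [← kerMap_conj]; rfl
  rw [ContinuousLinearMap.adjoint_inner_left, h1, h2, inner_smul_left, RKHS.kerFun_inner,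
    RKHS.kerFun_inner, hT]
  simp [scalarWeight]

variable (Ω H₁ H₂) in
/-- The factorization of the jet kernel through the tensor product of the two spaces. -/
noncomputable def jetFactor (n : ℕ) (a : Ω) : EuclideanSpace ℂ (Fin (n + 1)) →ₗ[ℂ] H₁ ⊗[ℂ] H₂ where
  toFun v := kerMap Ω H₁ (conj (a : ℂ)) ⊗ₜ[ℂ]
    ∑ j, v j • iteratedDeriv j (kerMap Ω H₂) (conj (a : ℂ))
  map_add' u v := by simp [add_smul, Finset.sum_add_distrib, TensorProduct.tmul_add]
  map_smul' c v := by
    rw [RingHom.id_apply, ← TensorProduct.tmul_smul, Finset.smul_sum]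
    simp [mul_smul]

lemma jetFactor_apply (n : ℕ) (a : Ω) (v : EuclideanSpace ℂ (Fin (n + 1))) :
    jetFactor Ω H₁ H₂ n a v = kerMap Ω H₁ (conj (a : ℂ)) ⊗ₜ[ℂ]
      ∑ j, v j • iteratedDeriv j (kerMap Ω H₂) (conj (a : ℂ)) := rfl

lemma isGram_jetFactor (hΩ : IsOpen Ω) (hH₁ : RKHS.kernel H₁ = scalarKernel Ω K₁)
    (hK₂ : SesquiAnalyticOn Ω K₂) (hH₂ : RKHS.kernel H₂ = scalarKernel Ω K₂) (n : ℕ) :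
    IsGram (jetKernel Ω n K₁ K₂) (jetFactor Ω H₁ H₂ n) := by
  intro a b u v
  rw [jetFactor_apply, jetFactor_apply, TensorProduct.inner_tmul, PiLp.inner_apply, sum_inner,
    Finset.mul_sum]
  refine Finset.sum_congr rfl fun i _ => ?_
  rw [jetKernel, Matrix.of_apply, toEuclideanCLM_apply, inner_sum, inner_sum, Finset.mul_sum]
  refine Finset.sum_congr rfl fun j _ => ?_
  rw [inner_kerMap hH₁ (by simp) (by simp), inner_smul_left, inner_smul_right,
    ← mixedDeriv_eq_inner hΩ hK₂ hH₂ i j a.2 b.2]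
  simp only [Complex.conj_conj, RCLike.inner_apply, Matrix.of_apply]
  ring

lemma continuous_jetFactor (hΩ : IsOpen Ω) (hK₁ : SesquiAnalyticOn Ω K₁)
    (hH₁ : RKHS.kernel H₁ = scalarKernel Ω K₁)
    (hK₂ : SesquiAnalyticOn Ω K₂) (hH₂ : RKHS.kernel H₂ = scalarKernel Ω K₂) (n : ℕ)
    (v : EuclideanSpace ℂ (Fin (n + 1))) : Continuous fun a : Ω => jetFactor Ω H₁ H₂ n a v := by
  have hU := isOpen_conj_preimage hΩ
  have hκ₁ := differentiableOn_kerMap hΩ hK₁ hH₁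
  have hκ₂ := differentiableOn_kerMap hΩ hK₂ hH₂
  have hc : Continuous fun a : Ω => conj (a : ℂ) :=
    Complex.continuous_conj.comp continuous_subtype_val
  have h1 : Continuous fun a : Ω => kerMap Ω H₁ (conj (a : ℂ)) :=
    hκ₁.continuousOn.comp_continuous hc fun a => by simp
  have h2 : ∀ j : ℕ, Continuous fun a : Ω => iteratedDeriv j (kerMap Ω H₂) (conj (a : ℂ)) :=
    fun j => by
    rw [iteratedDeriv_eq_iterate]
    exact ContinuousOn.comp_continuous (s := conj ⁻¹' Ω)
      (fun u hu => ((hκ₂.analyticAt (hU.mem_nhds hu)).iterated_deriv j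
        ).continuousAt.continuousWithinAt) hc fun a => by simp
  have h3 : Continuous fun a : Ω =>
      ∑ j : Fin (n + 1), v j • iteratedDeriv j (kerMap Ω H₂) (conj (a : ℂ)) :=
    continuous_finsetSum _ fun j _ => (h2 j).const_smul (v j)
  exact (TensorProduct.continuous_tmul (𝕜 := ℂ) (E := H₁) (F := H₂)).comp (h1.prodMk h3)

/-- The bounded operator `T₂.adjoint` commutes with derivatives, so differentiating `adjoint_kerMap`
expresses its action on the derivatives of `κ₂` by the conjugated matrix `𝒥_n ψ₂ · ℬ_n φ`. Summing
against `v` transposes it, and `T₁.adjoint` supplies the factor `conj ψ₁`. -/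
lemma mapL_jetFactor (hΩ : IsOpen Ω) (hK₂ : SesquiAnalyticOn Ω K₂)
    (hH₂ : RKHS.kernel H₂ = scalarKernel Ω K₂) {ψ₁ ψ₂ φ : ℂ → ℂ}
    (hψ₂ : DifferentiableOn ℂ ψ₂ Ω) (hφ : DifferentiableOn ℂ φ Ω) (hφΩ : Set.MapsTo φ Ω Ω)
    {T₁ : H₁ →L[ℂ] H₁} {T₂ : H₂ →L[ℂ] H₂}
    (hT₁ : IsWeightedComp (scalarWeight Ω ψ₁) (hφΩ.restrict φ Ω Ω) T₁)
    (hT₂ : IsWeightedComp (scalarWeight Ω ψ₂) (hφΩ.restrict φ Ω Ω) T₂) (n : ℕ) (b : Ω)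
    (v : EuclideanSpace ℂ (Fin (n + 1))) :
    TensorProduct.mapL T₁.adjoint T₂.adjoint (jetFactor Ω H₁ H₂ n b v) =
      jetFactor Ω H₁ H₂ n (hφΩ.restrict φ Ω Ω b)
        ((jetWeight Ω n ψ₁ ψ₂ φ b).adjoint v) := by
  have hU := isOpen_conj_preimage hΩ
  have hκ := differentiableOn_kerMap hΩ hK₂ hH₂
  have hb : conj (b : ℂ) ∈ (conj ⁻¹' Ω : Set ℂ) := by simp
  have hconj : ∀ f : ℂ → ℂ, DifferentiableOn ℂ f Ω →
      DifferentiableOn ℂ (fun u => conj (f (conj u))) (conj ⁻¹' Ω) := fun f hf u hu => by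
    have := (hf.differentiableAt (hΩ.mem_nhds hu)).conj_conj
    rw [Complex.conj_conj] at this
    exact this.differentiableWithinAt
  have h2 : ∀ j : Fin (n + 1), T₂.adjoint (iteratedDeriv j (kerMap Ω H₂) (conj (b : ℂ))) =
      ∑ l : Fin (n + 1), conj ((jetMatrix n ψ₂ b * bellMatrix n φ b) j l) •
        iteratedDeriv l (kerMap Ω H₂) (conj (φ b)) := by
    intro j
    rw [← iteratedDeriv_clm_apply _ hκ hU j hb]
    have he : (fun u => T₂.adjoint (kerMap Ω H₂ u)) =ᶠ[𝓝 (conj (b : ℂ))]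
        fun u => conj (ψ₂ (conj u)) • kerMap Ω H₂ (conj (φ (conj u))) := by
      filter_upwards [hU.mem_nhds hb] with u hu using adjoint_kerMap hT₂ hu
    rw [he.iteratedDeriv_eq, iteratedDeriv_smul_comp hU hκ (hconj _ hψ₂) (hconj _ hφ)
      (fun u hu => by simpa using hφΩ hu) hb j, jetMatrix_conj, bellMatrix_conj,
      ← Matrix.map_mul]
    simp
  have h1 : T₁.adjoint (kerMap Ω H₁ (conj (b : ℂ))) = conj (ψ₁ b) • kerMap Ω H₁ (conj (φ b)) := by
    simpa using adjoint_kerMap hT₁ (u := conj (b : ℂ)) (by simp)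
  have h3 : ∀ l, (jetWeight Ω n ψ₁ ψ₂ φ b).adjoint v l =
      ∑ j, conj (ψ₁ b * (jetMatrix n ψ₂ b * bellMatrix n φ b) j l) * v j := by
    intro l
    rw [jetWeight, ← ContinuousLinearMap.star_eq_adjoint, ← map_star, toEuclideanCLM_apply]
    simp [Matrix.star_apply]
  rw [jetFactor_apply, jetFactor_apply, TensorProduct.mapL_tmul, h1, TensorProduct.smul_tmul,
    map_sum, Set.MapsTo.val_restrict_apply]
  congr 1
  simp only [map_smul, h2, h3, Finset.smul_sum, Finset.sum_smul]
  rw [Finset.sum_comm]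
  refine Finset.sum_congr rfl fun l _ => Finset.sum_congr rfl fun j _ => ?_
  rw [smul_smul, smul_smul, map_mul]
  congr 1
  ring

end Factor

/-! ### Injectivity and two-sided bounds for the jet operator -/

section Injective

variable {Ω : Set ℂ}
  {H₁ : Type*} [NormedAddCommGroup H₁] [InnerProductSpace ℂ H₁] [CompleteSpace H₁] [RKHS ℂ H₁ Ω ℂ]
  {H₂ : Type*} [NormedAddCommGroup H₂] [InnerProductSpace ℂ H₂] [CompleteSpace H₂] [RKHS ℂ H₂ Ω ℂ]
  {K₁ K₂ : ℂ → ℂ → ℂ} {n : ℕ}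
  {H : Type*} [NormedAddCommGroup H] [InnerProductSpace ℂ H] [CompleteSpace H]
  [RKHS ℂ H Ω (EuclideanSpace ℂ (Fin (n + 1)))]

lemma norm_kerFun_sub_eq {X V E H : Type*} [NormedAddCommGroup V] [InnerProductSpace ℂ V]
    [CompleteSpace V] [NormedAddCommGroup E] [InnerProductSpace ℂ E] [NormedAddCommGroup H]
    [InnerProductSpace ℂ H] [CompleteSpace H] [RKHS ℂ H X V] {Γ : X → V →ₗ[ℂ] E}
    (hΓ : IsGram (RKHS.kernel H) Γ) (a b : X) (u v : V) :
    ‖RKHS.kerFun H a u - RKHS.kerFun H b v‖ = ‖Γ a u - Γ b v‖ := by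
  simpa only [map_sub, Finsupp.lsum_single, ContinuousLinearMap.coe_coe] using
    isGram_kerFun.norm_lsum_eq hΓ (Finsupp.single a u - Finsupp.single b v)

/-- Distances between kernel functions equal distances between the vectors `Γ a v`, so continuity
passes from `Γ` to kernel functions and thence to every `f`. -/
lemma continuous_of_isGram {X V E H : Type*} [TopologicalSpace X] [NormedAddCommGroup V]
    [InnerProductSpace ℂ V] [FiniteDimensional ℂ V] [NormedAddCommGroup E]
    [InnerProductSpace ℂ E] [NormedAddCommGroup H] [InnerProductSpace ℂ H] [CompleteSpace H]
    [CompleteSpace V] [RKHS ℂ H X V] {Γ : X → V →ₗ[ℂ] E} (hΓ : IsGram (RKHS.kernel H) Γ)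
    (hc : ∀ v, Continuous fun a => Γ a v) (f : H) (v : V) :
    Continuous fun x => ⟪v, f x⟫_ℂ := by
  have hk : Continuous fun a => RKHS.kerFun H a v := by
    refine continuous_iff_continuousAt.2 fun a => ?_
    have h := (hc v).tendsto a
    rw [tendsto_iff_norm_sub_tendsto_zero] at h
    rw [ContinuousAt, tendsto_iff_norm_sub_tendsto_zero]
    simpa only [norm_kerFun_sub_eq hΓ] using h
  simp only [← RKHS.kerFun_inner]
  exact hk.inner continuous_const

lemma subsingleton_of_isGram_zero {X V E H : Type*} [NormedAddCommGroup V]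
    [InnerProductSpace ℂ V] [CompleteSpace V] [NormedAddCommGroup E] [InnerProductSpace ℂ E]
    [NormedAddCommGroup H] [InnerProductSpace ℂ H] [CompleteSpace H] [RKHS ℂ H X V]
    {Γ : X → V →ₗ[ℂ] E} (hΓ : IsGram (RKHS.kernel H) Γ) (h0 : ∀ a v, Γ a v = 0) :
    Subsingleton H := by
  refine subsingleton_of_forall_eq 0 fun f => RKHS.ext fun x => ext_inner_left ℂ fun v => ?_
  have h : RKHS.kerFun H x v = 0 := by
    simpa [h0] using norm_kerFun_sub_eq hΓ x x v 0
  rw [← RKHS.kerFun_inner, ← RKHS.kerFun_inner, h, inner_zero_left, inner_zero_left]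

/-- A vanishing weight gives the zero operator, which is injective only on the trivial space. This
settles the case in which the identity theorem says nothing. -/
lemma subsingleton_of_weight_eqOn_zero {E : Type*} [NormedAddCommGroup E] [InnerProductSpace ℂ E]
    [RKHS ℂ E Ω ℂ] {ψ : ℂ → ℂ} {φ : Ω → Ω} (hψ : Set.EqOn ψ 0 Ω) {T : E →L[ℂ] E}
    (hT : IsWeightedComp (scalarWeight Ω ψ) φ T)
    (hinj : Function.Injective T) : Subsingleton E := by
  refine subsingleton_of_forall_eq 0 fun f => hinj (RKHS.ext fun x => ?_)
  rw [hT, map_zero, scalarWeight, hψ x.2]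
  simp

lemma eventually_ne_zero_of_not_eqOn_zero (hΩ : IsOpen Ω) (hΩ' : IsPreconnected Ω) {ψ : ℂ → ℂ}
    (hψ : DifferentiableOn ℂ ψ Ω) (h0 : ¬ Set.EqOn ψ 0 Ω) {z : ℂ} (hz : z ∈ Ω) :
    ∀ᶠ w in 𝓝[≠] z, ψ w ≠ 0 := by
  by_contra h
  exact h0 ((hψ.analyticOnNhd hΩ).eqOn_zero_of_preconnected_of_frequently_eq_zero hΩ' hz
    h)

/-- The jet weighted composition operator is injective, by the identity theorem. -/
lemma injective_of_isWeightedComp_jetWeight (hΩ : IsOpen Ω) (hΩ' : IsPreconnected Ω)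
    (hK₁ : SesquiAnalyticOn Ω K₁) (hH₁ : RKHS.kernel H₁ = scalarKernel Ω K₁)
    (hK₂ : SesquiAnalyticOn Ω K₂) (hH₂ : RKHS.kernel H₂ = scalarKernel Ω K₂)
    (hH : RKHS.kernel H = jetKernel Ω n K₁ K₂) {ψ₁ ψ₂ φ : ℂ → ℂ}
    (hψ₁ : DifferentiableOn ℂ ψ₁ Ω) (hψ₂ : DifferentiableOn ℂ ψ₂ Ω) (hφ : IsAut Ω φ)
    {T₁ : H₁ →L[ℂ] H₁} {T₂ : H₂ →L[ℂ] H₂} {T : H →L[ℂ] H}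
    (hT₁ : IsWeightedComp (scalarWeight Ω ψ₁) (hφ.mapsTo.restrict φ Ω Ω) T₁)
    (hT₂ : IsWeightedComp (scalarWeight Ω ψ₂) (hφ.mapsTo.restrict φ Ω Ω) T₂)
    (hT : IsWeightedComp (jetWeight Ω n ψ₁ ψ₂ φ) (hφ.mapsTo.restrict φ Ω Ω) T)
    (hinj₁ : Function.Injective T₁) (hinj₂ : Function.Injective T₂) :
    Function.Injective T := by
  have hΓ : IsGram (RKHS.kernel H) (jetFactor Ω H₁ H₂ n) :=
    hH ▸ isGram_jetFactor hΩ hH₁ hK₂ hH₂ n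
  by_cases h1 : Set.EqOn ψ₁ 0 Ω
  · have := subsingleton_of_weight_eqOn_zero h1 hT₁ hinj₁
    have : Subsingleton H := subsingleton_of_isGram_zero hΓ fun a v => by
      rw [jetFactor_apply, Subsingleton.elim (kerMap Ω H₁ _) 0, TensorProduct.zero_tmul]
    exact Function.injective_of_subsingleton T
  by_cases h2 : Set.EqOn ψ₂ 0 Ω
  · have := subsingleton_of_weight_eqOn_zero h2 hT₂ hinj₂
    have : Subsingleton H := subsingleton_of_isGram_zero hΓ fun a v => by
      rw [jetFactor_apply, Subsingleton.elim (Finset.sum _ _) (0 : H₂), TensorProduct.tmul_zero]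
    exact Function.injective_of_subsingleton T
  refine (injective_iff_map_eq_zero T).2 fun f hf => ?_
  have hpt : ∀ z : Ω, ψ₁ z ≠ 0 → ψ₂ z ≠ 0 → f (hφ.mapsTo.restrict φ Ω Ω z) = 0 := by
    intro z hz1 hz2
    refine eq_zero_of_jetWeight_apply_eq_zero hz1 hz2 (hφ.deriv_ne_zero hΩ z.2) ?_
    rw [← hT, hf, RKHS.coe_zero, Pi.zero_apply]
  have hall : ∀ z : Ω, f (hφ.mapsTo.restrict φ Ω Ω z) = 0 := by
    intro z
    refine ext_inner_left ℂ fun v => ?_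
    rw [inner_zero_right]
    have hcont : Continuous fun x : Ω => ⟪v, f (hφ.mapsTo.restrict φ Ω Ω x)⟫_ℂ :=
      (continuous_of_isGram hΓ (continuous_jetFactor hΩ hK₁ hH₁ hK₂ hH₂ n) f v).comp
        (hφ.differentiableOn.continuousOn.mapsToRestrict hφ.mapsTo)
    by_contra hne
    -- A nonzero value at `z` would persist nearby, while every punctured neighbourhood of `z`
    -- contains points with `ψ₁ ψ₂ ≠ 0`, where `hpt` forces the value zero.
    have hopen := hcont.continuousAt.eventually_ne hne
    rw [nhds_subtype_eq_comap, eventually_comap] at hopen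
    have hev := ((hopen.filter_mono nhdsWithin_le_nhds).and
      (eventually_ne_zero_of_not_eqOn_zero hΩ hΩ' hψ₁ h1 z.2)).and
      ((eventually_ne_zero_of_not_eqOn_zero hΩ hΩ' hψ₂ h2 z.2).and
        ((hΩ.eventually_mem z.2).filter_mono nhdsWithin_le_nhds))
    obtain ⟨w, ⟨hw0, hw1⟩, hw2, hwΩ⟩ := hev.exists
    exact hw0 ⟨w, hwΩ⟩ rfl (by rw [hpt ⟨w, hwΩ⟩ hw1 hw2, inner_zero_right])
  refine RKHS.ext fun x => ?_
  -- So far `f` vanishes on the image of `φ`, which is all of `Ω`.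
  obtain ⟨χ, -, hχ, -, hright⟩ := hφ.exists_inverse
  have hx : hφ.mapsTo.restrict φ Ω Ω ⟨χ x, hχ x.2⟩ = x := Subtype.ext (hright x.2)
  rw [← hx, hall, RKHS.coe_zero, Pi.zero_apply]

/-- Two-sided norm bounds for invertible scalar weighted composition operators pass to the jet
weighted composition operator. -/
lemma exists_jet_isWeightedComp (hΩ : IsOpen Ω) (hΩ' : IsPreconnected Ω)
    (hK₁ : SesquiAnalyticOn Ω K₁) (hH₁ : RKHS.kernel H₁ = scalarKernel Ω K₁)
    (hK₂ : SesquiAnalyticOn Ω K₂) (hH₂ : RKHS.kernel H₂ = scalarKernel Ω K₂)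
    (hH : RKHS.kernel H = jetKernel Ω n K₁ K₂) {ψ₁ ψ₂ φ : ℂ → ℂ}
    (hψ₁ : DifferentiableOn ℂ ψ₁ Ω) (hψ₂ : DifferentiableOn ℂ ψ₂ Ω) (hφ : IsAut Ω φ)
    {T₁ S₁ : H₁ →L[ℂ] H₁} {T₂ S₂ : H₂ →L[ℂ] H₂}
    (hT₁ : IsWeightedComp (scalarWeight Ω ψ₁) (hφ.mapsTo.restrict φ Ω Ω) T₁)
    (hT₂ : IsWeightedComp (scalarWeight Ω ψ₂) (hφ.mapsTo.restrict φ Ω Ω) T₂)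
    (h₁ : S₁ * T₁ = 1) (h₁' : T₁ * S₁ = 1) (h₂ : S₂ * T₂ = 1) (h₂' : T₂ * S₂ = 1) :
    ∃ R : H →L[ℂ] H,
      IsWeightedComp (jetWeight Ω n ψ₁ ψ₂ φ) (hφ.mapsTo.restrict φ Ω Ω) R.adjoint ∧ IsUnit R ∧
      (∀ h, ‖R h‖ ≤ ‖T₁‖ * ‖T₂‖ * ‖h‖) ∧ ∀ h, ‖h‖ ≤ ‖S₁‖ * ‖S₂‖ * ‖R h‖ := by
  have hΓ : IsGram (RKHS.kernel H) (jetFactor Ω H₁ H₂ n) :=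
    hH ▸ isGram_jetFactor hΩ hH₁ hK₂ hH₂ n
  have hle : ∀ (A : H₁ →L[ℂ] H₁) (B : H₂ →L[ℂ] H₂) (x : H₁ ⊗[ℂ] H₂),
      ‖TensorProduct.mapL A.adjoint B.adjoint x‖ ≤ ‖A‖ * ‖B‖ * ‖x‖ := by
    intro A B x
    refine (ContinuousLinearMap.le_opNorm _ _).trans ?_
    gcongr
    simpa using TensorProduct.norm_mapL_le A.adjoint B.adjoint
  -- This left inverse yields the lower bound. It does not by itself invert the induced operator,
  -- since the `Sᵢ` are not known to be weighted compositions; injectivity of the adjoint fills that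
  -- gap.
  have hinv : ∀ x : H₁ ⊗[ℂ] H₂, TensorProduct.mapL S₁.adjoint S₂.adjoint
      (TensorProduct.mapL T₁.adjoint T₂.adjoint x) = x := by
    intro x
    rw [← ContinuousLinearMap.comp_apply, ← TensorProduct.mapL_comp,
      ← ContinuousLinearMap.adjoint_comp, ← ContinuousLinearMap.adjoint_comp]
    rw [show T₁ ∘L S₁ = .id ℂ H₁ from h₁', show T₂ ∘L S₂ = .id ℂ H₂ from h₂',
      show (ContinuousLinearMap.id ℂ H₁).adjoint = .id ℂ H₁ from star_one (H₁ →L[ℂ] H₁),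
      show (ContinuousLinearMap.id ℂ H₂).adjoint = .id ℂ H₂ from star_one (H₂ →L[ℂ] H₂),
      TensorProduct.mapL_id_id]
    rfl
  obtain ⟨R, hR, hC, hc⟩ := exists_isWeightedComp hΓ
    (mapL_jetFactor hΩ hK₂ hH₂ hψ₂ hφ.differentiableOn hφ.mapsTo hT₁ hT₂ n) (hle T₁ T₂)
    (c := ‖S₁‖ * ‖S₂‖) fun x => by
      conv_lhs => rw [← hinv x]
      exact hle S₁ S₂ _
  refine ⟨R, hR, isUnit_of_bounded_below hc ?_, hC, hc⟩
  exact injective_of_isWeightedComp_jetWeight hΩ hΩ' hK₁ hH₁ hK₂ hH₂ hH hψ₁ hψ₂ hφ hT₁ hT₂ hR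
    (Function.LeftInverse.injective (g := S₁) fun x => congrArg (fun A : H₁ →L[ℂ] H₁ => A x) h₁)
    (Function.LeftInverse.injective (g := S₂) fun x => congrArg (fun A : H₂ →L[ℂ] H₂ => A x) h₂)

end Injective

/-- An inequality rather than an equality, so that trivial spaces, where the identity has norm zero,
are covered. -/
lemma norm_le_one_of_mem_unitary {A : Type*} [NormedRing A] [StarRing A] [CStarRing A] {a : A}
    (ha : a ∈ unitary A) : ‖a‖ ≤ 1 := by
  nontriviality A
  exact (CStarRing.norm_of_mem_unitary ha).le

/-- An isometric invertible operator is unitary. -/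
lemma adjoint_mem_unitary {H : Type*} [NormedAddCommGroup H] [InnerProductSpace ℂ H]
    [CompleteSpace H] {R : H →L[ℂ] H} (hR : IsUnit R) (h : ∀ x, ‖R x‖ = ‖x‖) :
    R.adjoint ∈ unitary (H →L[ℂ] H) := by
  have h1 : star R * R = 1 := (ContinuousLinearMap.norm_map_iff_adjoint_comp_self R).1 h
  obtain ⟨u, rfl⟩ := hR
  have h2 : star (u : H →L[ℂ] H) = ↑u⁻¹ := Units.eq_inv_of_mul_eq_one_right h1
  refine Unitary.star_mem (U := (u : H →L[ℂ] H)) (Unitary.mem_iff.2 ⟨h1, ?_⟩)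
  rw [h2, Units.mul_inv]

end JetKernel

/-! ### The main theorem -/

theorem mainTheorem8
    {Ω : Set ℂ} (hΩ_open : IsOpen Ω) (hΩ_conn : IsConnected Ω) (hΩ_bdd : Bornology.IsBounded Ω)
    -- two sesqui-analytic kernels and their reproducing kernel Hilbert spaces
    {K₁ K₂ : ℂ → ℂ → ℂ}
    (hK₁ : JetKernel.SesquiAnalyticOn Ω K₁) (hK₂ : JetKernel.SesquiAnalyticOn Ω K₂)
    {H₁ : Type*} [NormedAddCommGroup H₁] [InnerProductSpace ℂ H₁] [CompleteSpace H₁]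
    [RKHS ℂ H₁ Ω ℂ] (hH₁ : RKHS.kernel H₁ = JetKernel.scalarKernel Ω K₁)
    {H₂ : Type*} [NormedAddCommGroup H₂] [InnerProductSpace ℂ H₂] [CompleteSpace H₂]
    [RKHS ℂ H₂ Ω ℂ] (hH₂ : RKHS.kernel H₂ = JetKernel.scalarKernel Ω K₂)
    -- multiplication by the coordinate function is bounded on both spaces
    (hM₁ : JetKernel.WeightedCompBounded H₁ (JetKernel.scalarWeight Ω (fun z => z)) id)
    (hM₂ : JetKernel.WeightedCompBounded H₂ (JetKernel.scalarWeight Ω (fun z => z)) id)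
    {ψ₁ ψ₂ φ : ℂ → ℂ} (hψ₁ : DifferentiableOn ℂ ψ₁ Ω) (hψ₂ : DifferentiableOn ℂ ψ₂ Ω)
    (hφ : JetKernel.IsAut Ω φ) (n : ℕ) :
    -- the jet kernel is a non-negative definite kernel
    (JetKernel.jetKernel Ω n K₁ K₂).PosSemidef ∧
    -- and on its reproducing kernel Hilbert space `H` the two assertions hold
    ∀ {H : Type*} [NormedAddCommGroup H] [InnerProductSpace ℂ H] [CompleteSpace H]
      [RKHS ℂ H Ω (EuclideanSpace ℂ (Fin (n + 1)))],
      RKHS.kernel H = JetKernel.jetKernel Ω n K₁ K₂ →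
      (JetKernel.WeightedCompInvertible H₁ (JetKernel.scalarWeight Ω ψ₁)
          (hφ.mapsTo.restrict φ Ω Ω) →
        JetKernel.WeightedCompInvertible H₂ (JetKernel.scalarWeight Ω ψ₂)
          (hφ.mapsTo.restrict φ Ω Ω) →
        JetKernel.WeightedCompInvertible H (JetKernel.jetWeight Ω n ψ₁ ψ₂ φ)
          (hφ.mapsTo.restrict φ Ω Ω)) ∧
      (JetKernel.WeightedCompUnitary H₁ (JetKernel.scalarWeight Ω ψ₁)
          (hφ.mapsTo.restrict φ Ω Ω) →
        JetKernel.WeightedCompUnitary H₂ (JetKernel.scalarWeight Ω ψ₂)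
          (hφ.mapsTo.restrict φ Ω Ω) →
        JetKernel.WeightedCompUnitary H (JetKernel.jetWeight Ω n ψ₁ ψ₂ φ)
          (hφ.mapsTo.restrict φ Ω Ω)) := by
  refine ⟨(JetKernel.isGram_jetFactor hΩ_open hH₁ hK₂ hH₂ n).posSemidef, ?_⟩
  intro H _ _ _ _ hH
  refine ⟨?_, ?_⟩
  · rintro ⟨_, hT₁, ⟨u₁, rfl⟩⟩ ⟨_, hT₂, ⟨u₂, rfl⟩⟩
    obtain ⟨R, hR, hunit, -, -⟩ := JetKernel.exists_jet_isWeightedComp (H := H) hΩ_open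
      hΩ_conn.isPreconnected hK₁ hH₁ hK₂ hH₂ hH hψ₁ hψ₂ hφ hT₁ hT₂
      u₁.inv_mul u₁.mul_inv u₂.inv_mul u₂.mul_inv
    exact ⟨R.adjoint, hR, hunit.star⟩
  · rintro ⟨T₁, hT₁, hu₁⟩ ⟨T₂, hT₂, hu₂⟩
    obtain ⟨R, hR, hunit, hC, hc⟩ := JetKernel.exists_jet_isWeightedComp (H := H) hΩ_open
      hΩ_conn.isPreconnected hK₁ hH₁ hK₂ hH₂ hH hψ₁ hψ₂ hφ hT₁ hT₂
      (Unitary.star_mul_self_of_mem hu₁) (Unitary.mul_star_self_of_mem hu₁)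
      (Unitary.star_mul_self_of_mem hu₂) (Unitary.mul_star_self_of_mem hu₂)
    -- With `Sᵢ = star Tᵢ` both constants are products of norms of unitaries, so the two bounds
    -- squeeze `‖R x‖` to `‖x‖`.
    refine ⟨R.adjoint, hR, JetKernel.adjoint_mem_unitary hunit fun x => le_antisymm ?_ ?_⟩
    · refine (hC x).trans (mul_le_of_le_one_left (norm_nonneg _) (mul_le_one₀ ?_ (norm_nonneg _) ?_))
      exacts [JetKernel.norm_le_one_of_mem_unitary hu₁, JetKernel.norm_le_one_of_mem_unitary hu₂]
    · refine (hc x).trans (mul_le_of_le_one_left (norm_nonneg _) (mul_le_one₀ ?_ (norm_nonneg _) ?_))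
      exacts [JetKernel.norm_le_one_of_mem_unitary (Unitary.star_mem hu₁),
        JetKernel.norm_le_one_of_mem_unitary (Unitary.star_mem hu₂)]
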